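/- Let $(-1)^z=e^{i\pi z}$, let $\mathrm{Ei}(x)=\int_{-\infty}^{x}\frac{e^t}{t}\,dt$ for $x<0$, and let $A$ be the alternating Kurepa function: for $\mathrm{Re}\,z>0$, $$A(z)=\int_0^\infty e^{-t}\,\frac{t^{z+1}-(-1)^z t}{t+1}\,dt ,$$ continued meromorphically to $\mathbb C$ by $A(z)=\Gamma(z+2)-A(z+1)$ (with poles at most at $z=-2,-3,\dots$). For a function $f$ meromorphic at $a\in\mathbb C$, the principal value at the point $a$ is $$\mathop{\mathrm{p.v.}}_{z=a}f(z)=\lim_{\rho\to0^+}\frac1{2\pi i}\oint_{|z-a|=\rho}\frac{f(z)}{z-a}\,dz ,$$ whenever this limit exists. **Theorem.** For every $z\in\mathbb C\setminus\mathbb Z$ the series below converges absolutely and $$A(z)=-\bigl(1+e\,\mathrm{Ei}(-1)\bigr)(-1)^z+\frac{\pi e}{\sin\pi z}+\sum_{n=0}^{\infty}(-1)^n\,\Gamma(z+1-n).$$ At integer points the formula holds in the sense of principal values: for every $m\in\mathbb Z$ all the principal values below exist, the last series converges absolutely, and $$\mathop{\mathrm{p.v.}}_{z=m}A(z)=-\bigl(1+e\,\mathrm{Ei}(-1)\bigr)(-1)^m+\mathop{\mathrm{p.v.}}_{z=m}\frac{\pi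 e}{\sin\pi z}+\mathop{\mathrm{p.v.}}_{z=m}\sum_{n=0}^{\infty}(-1)^n\,\Gamma(z+1-n),$$ $$\mathop{\mathrm{p.v.}}_{z=m}\sum_{n=0}^{\infty}(-1)^n\,\Gamma(z+1-n)=\sum_{n=0}^{\infty}\mathop{\mathrm{p.v.}}_{z=m}\,(-1)^n\,\Gamma(z+1-n),$$ where $\mathop{\mathrm{p.v.}}_{z=m}A(z)=A(m)$ if $m\ge-1$. -/

import Mathlib

open Filter Topology MeasureTheory

noncomputable section

namespace AltKurepa

/-- The exponential integral `Ei x = ∫_{-∞}^x e^t / t dt`, for `x < 0`. -/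
def Ei (x : ℝ) : ℝ := ∫ t in Set.Iic x, Real.exp t / t

/-- The integral `∫_0^∞ e^{-t} (t^{z+1} - (-1)^z t) / (t+1) dt`, which converges for `0 < Re z`.
The power `(-1)^z` is the principal one, `exp (i π z)`. -/
def integralA (z : ℂ) : ℂ :=
  ∫ t in Set.Ioi (0 : ℝ),
    Complex.exp (-(t : ℂ)) * (((t : ℂ) ^ (z + 1) - (-1 : ℂ) ^ z * t) / ((t : ℂ) + 1))

/-- `n` steps of the continuation `A z = Γ(z+2) - A(z+1)`, starting from the integral. -/
def continuedA : ℕ → ℂ → ℂ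
  | 0, z => integralA z
  | n + 1, z => Complex.Gamma (z + 2) - continuedA n (z + 1)

/-- The alternating Kurepa function: given by the integral for `0 < Re z`, and continued to
`Re z ≤ 0` by `A z = Γ(z+2) - A(z+1)`. The number `⌊1 - Re z⌋₊` is the least
natural number `n` with `0 < Re (z + n)`. The value at a pole (`z = -2, -3, …`) is immaterial. -/
def A (z : ℂ) : ℂ := continuedA ⌊1 - z.re⌋₊ z

/-- The meromorphic function `f` has principal value `v` at the point `a`:
`v = lim_{ρ → 0+} (2πi)⁻¹ ∮_{|z-a|=ρ} f(z) / (z-a) dz`. -/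
def HasPrincipalValue (f : ℂ → ℂ) (a v : ℂ) : Prop :=
  MeromorphicAt f a ∧
    Tendsto (fun ρ : ℝ => (2 * (Real.pi : ℂ) * Complex.I)⁻¹ * ∮ z in C(a, ρ), f z / (z - a))
      (𝓝[>] 0) (𝓝 v)

end AltKurepa

end

/-! Let M(s) be the Mellin transform of e^{-t}/(1+t). The defining integral splits as A(z) = M(z+2)
- (-1)^z M(2), and M(2) = 1 + e Ei(-1). By Euler reflection, (-1)^n Γ(z+1-n) = -(π / sin πz) /
Γ(n-z), so the theorem off ℤ amounts to M(s) = (π / sin πs)(e - S(s-2)) with S(z) = ∑ 1/Γ(n-z), an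
entire function.

For 0 < Re s < 1, M(s) is Γ(s) times e times an upper incomplete gamma function at 1
(`mellin_expKernel_eq_gamma_mul`). This is the full Γ(1-s) minus its part over [0,1], which expands
into S (`hasSum_gamma_div_gamma`). The identity theorem extends the formula to Re s > 0, and the
common recursion A(z) = Γ(z+2) - A(z+1) carries it further left.

At an integer m every function involved is h(z)/(z-m) with h analytic, and its principal value is
h'(m). Additivity is then linearity of the derivative, and the termwise statement is termwise
differentiation of S. -/

namespace AltKurepa

/-! ### Principal values at simple poles -/

/-- A function with at most a simple pole, written as `h z / (z - a)` with `h` analytic at `a`,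
has principal value `h' a`. -/
theorem hasPrincipalValue_of_eventuallyEq_div {f h : ℂ → ℂ} {a : ℂ} (hh : AnalyticAt ℂ h a)
    (hf : f =ᶠ[𝓝[≠] a] fun z => h z / (z - a)) : HasPrincipalValue f a (deriv h a) := by
  constructor
  · exact MeromorphicAt.congr (by fun_prop) hf.symm
  · obtain ⟨r, hr, hr'⟩ := Metric.eventually_nhds_iff_ball.1
      (hh.eventually_analyticAt.and (eventually_nhdsWithin_iff.1 hf))
    refine tendsto_const_nhds.congr' ?_
    filter_upwards [Ioo_mem_nhdsGT hr] with ρ hρ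
    have hsub : Metric.closedBall a ρ ⊆ Metric.ball a r :=
      Metric.closedBall_subset_ball hρ.2
    -- By Cauchy's formula for the derivative, the mean is exactly `deriv h a` for every small ρ.
    rw [← Complex.two_pi_I_inv_smul_circleIntegral_sub_sq_inv_smul_of_differentiable
      Metric.isOpen_ball hsub
      (fun z hz => (hr' z hz).1.differentiableAt.differentiableWithinAt)
      (Metric.mem_ball_self hρ.1), smul_eq_mul]
    congr 1
    refine circleIntegral.integral_congr hρ.1.le fun z hz => ?_
    have hza : z ≠ a := by
      rintro rfl
      simp at hz
      exact hρ.1.ne hz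
    rw [(hr' z (hsub (Metric.sphere_subset_closedBall hz))).2 hza, smul_eq_mul]
    have := sub_ne_zero.2 hza
    field_simp

/-- An analytic function has its value as principal value. -/
theorem hasPrincipalValue_of_analyticAt {f : ℂ → ℂ} {a : ℂ} (hf : AnalyticAt ℂ f a) :
    HasPrincipalValue f a (f a) := by
  have hd : deriv (fun z => (z - a) * f z) a = f a := by
    have := ((hasDerivAt_id' a).sub_const a).fun_mul hf.differentiableAt.hasDerivAt
    simpa using this.deriv
  rw [← hd]
  refine hasPrincipalValue_of_eventuallyEq_div (by fun_prop) ?_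
  filter_upwards [self_mem_nhdsWithin] with z hz
  rw [mul_div_cancel_left₀ _ (sub_ne_zero.2 hz)]

/-- If `h z / (z - a)` has a limit at `a`, the limit is `h' a`. -/
theorem deriv_eq_of_tendsto_div {h : ℂ → ℂ} {a L : ℂ} (hh : AnalyticAt ℂ h a)
    (hL : Tendsto (fun z => h z / (z - a)) (𝓝[≠] a) (𝓝 L)) : deriv h a = L := by
  have h0 : h a = 0 := by
    have h1 : Tendsto h (𝓝[≠] a) (𝓝 (h a)) := hh.continuousAt.tendsto.mono_left inf_le_left
    have h2 : Tendsto (fun z => h z / (z - a) * (z - a)) (𝓝[≠] a) (𝓝 (L * (a - a))) :=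
      hL.mul (Continuous.tendsto (by fun_prop) a |>.mono_left inf_le_left)
    rw [sub_self, mul_zero] at h2
    refine tendsto_nhds_unique (h1.congr' ?_) h2
    filter_upwards [self_mem_nhdsWithin] with z hz
    rw [div_mul_cancel₀ _ (sub_ne_zero.2 hz)]
  have h3 := hasDerivAt_iff_tendsto_slope.1 hh.differentiableAt.hasDerivAt
  refine tendsto_nhds_unique h3 (hL.congr fun z => ?_)
  simp [slope_def_field, h0]

/-! ### The reciprocal gamma series and reflection -/

/-- The entire function `∑ 1 / Γ(n - z)`. -/
noncomputable def recipGammaSum (z : ℂ) : ℂ := ∑' n : ℕ, (Complex.Gamma (n - z))⁻¹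

theorem differentiable_recipGamma_sub (n : ℕ) :
    Differentiable ℂ fun z : ℂ => (Complex.Gamma (n - z))⁻¹ :=
  Complex.differentiable_one_div_Gamma.comp (by fun_prop : Differentiable ℂ fun z : ℂ => n - z)

/-- On every ball, the series `∑ 1 / Γ(n - z)` is dominated by a convergent series. -/
theorem exists_summable_bound_recipGamma (R : ℝ) : ∃ u : ℕ → ℝ, Summable u ∧
    ∀ n : ℕ, ∀ z ∈ Metric.ball (0 : ℂ) R, ‖(Complex.Gamma (n - z))⁻¹‖ ≤ u n := by
  have hb (n : ℕ) : ∃ C : ℝ, ∀ z ∈ Metric.closedBall (0 : ℂ) R,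
      ‖(Complex.Gamma (n - z))⁻¹‖ ≤ C :=
    (isCompact_closedBall (0 : ℂ) R).exists_bound_of_continuousOn
      (differentiable_recipGamma_sub n).continuous.continuousOn
  choose C hC using hb
  -- Past this N the factor w = k + N - z in 1/Γ(w) = w/Γ(w+1) has norm at least 2, so each step
  -- halves the bound.
  obtain ⟨N, hN⟩ := exists_nat_gt (R + 2)
  have hdecay (k : ℕ) (z : ℂ) (hz : z ∈ Metric.ball (0 : ℂ) R) :
      ‖(Complex.Gamma ((k + N : ℕ) - z))⁻¹‖ ≤ C N * (1 / 2) ^ k := by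
    induction k with
    | zero => simpa using hC N z (Metric.ball_subset_closedBall hz)
    | succ k ih =>
      rw [Complex.one_div_Gamma_eq_self_mul_one_div_Gamma_add_one, norm_mul] at ih
      have hn : 2 ≤ ‖((k + N : ℕ) : ℂ) - z‖ := by
        have h1 := norm_sub_norm_le ((k + N : ℕ) : ℂ) z
        have h2 : ‖z‖ < R := by simpa using hz
        rw [Complex.norm_natCast] at h1
        push_cast at h1 ⊢
        have : (0 : ℝ) ≤ k := k.cast_nonneg
        linarith
      have he : ((k + 1 + N : ℕ) : ℂ) - z = ((k + N : ℕ) : ℂ) - z + 1 := by push_cast; ring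
      rw [he, pow_succ]
      have := mul_le_mul_of_nonneg_right hn
        (norm_nonneg (Complex.Gamma (((k + N : ℕ) : ℂ) - z + 1))⁻¹)
      linarith
  refine ⟨fun n => if n < N then C n else C N * (1 / 2) ^ (n - N), ?_, fun n z hz => ?_⟩
  · rw [← summable_nat_add_iff N]
    simpa using summable_geometric_two.mul_left (C N)
  · dsimp only
    split_ifs with h
    · exact hC n z (Metric.ball_subset_closedBall hz)
    · obtain ⟨k, rfl⟩ := Nat.exists_eq_add_of_le' (not_lt.1 h)
      simpa using hdecay k z hz

theorem summable_recipGamma (z : ℂ) : Summable fun n : ℕ => (Complex.Gamma (n - z))⁻¹ := by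
  obtain ⟨u, hu, hb⟩ := exists_summable_bound_recipGamma (‖z‖ + 1)
  exact hu.of_norm_bounded fun n => hb n z (by simp)

theorem differentiable_recipGammaSum : Differentiable ℂ recipGammaSum := fun z => by
  obtain ⟨u, hu, hb⟩ := exists_summable_bound_recipGamma (‖z‖ + 1)
  exact (Complex.differentiableOn_tsum_of_summable_norm hu
    (fun n => (differentiable_recipGamma_sub n).differentiableOn) Metric.isOpen_ball hb)
    |>.differentiableAt (Metric.isOpen_ball.mem_nhds (by simp))

theorem hasSum_deriv_recipGamma (z : ℂ) :
    HasSum (fun n : ℕ => deriv (fun w : ℂ => (Complex.Gamma (n - w))⁻¹) z)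
      (deriv recipGammaSum z) := by
  obtain ⟨u, hu, hb⟩ := exists_summable_bound_recipGamma (‖z‖ + 1)
  exact Complex.hasSum_deriv_of_summable_norm hu
    (fun n => (differentiable_recipGamma_sub n).differentiableOn) Metric.isOpen_ball hb (by simp)

theorem recipGammaSum_add_one (z : ℂ) :
    recipGammaSum (z + 1) = (Complex.Gamma (-1 - z))⁻¹ + recipGammaSum z := by
  rw [recipGammaSum, (summable_recipGamma (z + 1)).tsum_eq_zero_add, recipGammaSum]
  congr 1
  · congr 2; push_cast; ring
  · refine tsum_congr fun n => ?_
    congr 2; push_cast; ring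

theorem sin_pi_mul_ne_zero {z : ℂ} (hz : ∀ m : ℤ, z ≠ m) : Complex.sin (Real.pi * z) ≠ 0 := by
  rw [Complex.sin_ne_zero_iff]
  intro k hk
  refine hz k (mul_left_cancel₀ (Complex.ofReal_ne_zero.2 Real.pi_ne_zero) ?_)
  rw [hk, mul_comm]

theorem gamma_mul_gamma_sub {z : ℂ} (n : ℕ) :
    (-1 : ℂ) ^ n * (Complex.Gamma (z + 1 - n) * Complex.Gamma (n - z)) =
      -(Real.pi / Complex.sin (Real.pi * z)) := by
  have h := Complex.Gamma_mul_Gamma_one_sub (z + 1 - n)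
  rw [show 1 - (z + 1 - n) = n - z by ring,
    show (Real.pi : ℂ) * (z + 1 - n) = (Real.pi * z + Real.pi) - n * Real.pi by ring,
    Complex.sin_antiperiodic.sub_nat_mul_eq, Complex.sin_add_pi] at h
  rw [h]
  rcases neg_one_pow_eq_or ℂ n with h | h <;> simp [h, div_neg]

/-- Reflection of the terms of the series. -/
theorem neg_one_pow_mul_gamma {z : ℂ} (hz : ∀ m : ℤ, z ≠ m) (n : ℕ) :
    (-1 : ℂ) ^ n * Complex.Gamma (z + 1 - n) =
      -(Real.pi / Complex.sin (Real.pi * z)) * (Complex.Gamma (n - z))⁻¹ := by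
  have hG : Complex.Gamma (n - z) ≠ 0 := Complex.Gamma_ne_zero fun k hk => hz (n + k) (by
    push_cast; linear_combination -hk)
  rw [← gamma_mul_gamma_sub n, ← mul_assoc, mul_assoc _ _ (_⁻¹), mul_inv_cancel₀ hG, mul_one]

theorem hasSum_gamma {z : ℂ} (hz : ∀ m : ℤ, z ≠ m) :
    HasSum (fun n : ℕ => (-1 : ℂ) ^ n * Complex.Gamma (z + 1 - n))
      (-(Real.pi / Complex.sin (Real.pi * z)) * recipGammaSum z) := by
  simp_rw [neg_one_pow_mul_gamma hz]
  exact (summable_recipGamma z).hasSum.mul_left _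

/-! ### The Mellin transform of the kernel and its relation to A -/

/-- The function `e^{-t} / (1 + t)`, whose Mellin transform at `z + 2` is the `t^{z+1}` part
of the integral for the alternating Kurepa function. -/
noncomputable def expKernel (t : ℝ) : ℂ := ((Real.exp (-t) / (1 + t) : ℝ) : ℂ)

theorem locallyIntegrableOn_expKernel : LocallyIntegrableOn expKernel (Set.Ioi 0) := by
  refine ContinuousOn.locallyIntegrableOn ?_ measurableSet_Ioi
  refine Complex.continuous_ofReal.comp_continuousOn ?_
  refine ContinuousOn.div (by fun_prop) (by fun_prop) fun t ht => ?_
  have : (0 : ℝ) < t := ht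
  positivity

theorem norm_expKernel_le {t : ℝ} (ht : 0 < t) : ‖expKernel t‖ ≤ Real.exp (-t) := by
  rw [expKernel, Complex.norm_real, Real.norm_of_nonneg (by positivity)]
  exact div_le_self (Real.exp_pos _).le (by linarith)

theorem isBigO_expKernel_atTop : expKernel =O[atTop] fun t => Real.exp (-1 * t) := by
  refine Asymptotics.IsBigO.of_bound 1 ?_
  filter_upwards [eventually_gt_atTop 0] with t ht
  simpa using norm_expKernel_le ht

theorem isBigO_expKernel_zero : expKernel =O[𝓝[>] 0] fun t => t ^ (-0 : ℝ) := by
  refine Asymptotics.IsBigO.of_bound 1 ?_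
  filter_upwards [self_mem_nhdsWithin] with t ht
  have ht : 0 < t := ht
  simpa using (norm_expKernel_le ht).trans (Real.exp_le_one_iff.2 (by linarith))

theorem mellinConvergent_expKernel {s : ℂ} (hs : 0 < s.re) : MellinConvergent expKernel s :=
  mellinConvergent_of_isBigO_rpow_exp one_pos locallyIntegrableOn_expKernel
    isBigO_expKernel_atTop isBigO_expKernel_zero hs

theorem differentiableAt_mellin_expKernel {s : ℂ} (hs : 0 < s.re) :
    DifferentiableAt ℂ (mellin expKernel) s :=
  mellin_differentiableAt_of_isBigO_rpow_exp one_pos locallyIntegrableOn_expKernel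
    isBigO_expKernel_atTop isBigO_expKernel_zero hs

/-- Since t^s + t^{s-1} = t^{s-1}(1+t), adding the two transforms cancels the denominator and leaves
the Gamma integral. -/
theorem mellin_expKernel_add_one {s : ℂ} (hs : 0 < s.re) :
    mellin expKernel (s + 1) = Complex.Gamma s - mellin expKernel s := by
  have hs1 : 0 < (s + 1).re := by simp; linarith
  rw [eq_sub_iff_add_eq, mellin, mellin, ← integral_add (mellinConvergent_expKernel hs1)
    (mellinConvergent_expKernel hs), Complex.Gamma_eq_integral hs, Complex.GammaIntegral]
  refine setIntegral_congr_fun measurableSet_Ioi fun t ht => ?_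
  have ht0 : 0 < t := ht
  have ht' : (t : ℂ) ≠ 0 := by exact_mod_cast ht0.ne'
  have ht1 : (1 + t : ℂ) ≠ 0 := by exact_mod_cast (by positivity : 1 + t ≠ 0)
  have hp : (t : ℂ) ^ (s + 1 - 1) = (t : ℂ) ^ (s - 1) * t := by
    rw [show s + 1 - 1 = (s - 1) + 1 by ring, Complex.cpow_add _ _ ht', Complex.cpow_one]
  simp only [smul_eq_mul, hp, expKernel]
  push_cast
  field_simp
  ring

theorem setIntegral_Ioi_comp_add_one {E : Type*} [NormedAddCommGroup E] [NormedSpace ℝ E]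
    (f : ℝ → E) : ∫ t in Set.Ioi (0 : ℝ), f (t + 1) = ∫ t in Set.Ioi (1 : ℝ), f t := by
  have h := (measurePreserving_add_right volume (1 : ℝ)).setIntegral_preimage_emb
    (measurableEmbedding_addRight 1) f (Set.Ioi 1)
  simpa using h

/-- Substitute v = 1 + t, then reverse the sign of the variable. -/
theorem mellin_expKernel_one : mellin expKernel 1 = -((Real.exp 1 : ℂ) * (Ei (-1) : ℂ)) := by
  have h1 : ∫ t in Set.Ioi (0 : ℝ), Real.exp (-t) / (1 + t) = -(Real.exp 1 * Ei (-1)) := by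
    rw [Ei, ← integral_comp_neg_Ioi 1 (fun t => Real.exp t / t),
      ← setIntegral_Ioi_comp_add_one (fun t => Real.exp (-t) / -t), ← integral_const_mul,
      ← integral_neg]
    refine setIntegral_congr_fun measurableSet_Ioi fun t ht => ?_
    simp only [div_neg, mul_neg, neg_neg]
    rw [← mul_div_assoc, ← Real.exp_add, add_comm t 1]
    congr 2
    ring
  rw [← Complex.ofReal_mul, ← Complex.ofReal_neg, ← h1, mellin, ← integral_complex_ofReal]
  simp [expKernel]

theorem mellin_expKernel_two :
    mellin expKernel 2 = 1 + (Real.exp 1 : ℂ) * (Ei (-1) : ℂ) := by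
  have h := mellin_expKernel_add_one (s := 1) (by simp)
  rw [one_add_one_eq_two, mellin_expKernel_one, Complex.Gamma_one] at h
  rw [h, sub_neg_eq_add]

theorem integralA_eq {z : ℂ} (hz : -2 < z.re) :
    integralA z = mellin expKernel (z + 2) - (-1 : ℂ) ^ z * mellin expKernel 2 := by
  have h1 : 0 < (z + 2).re := by simp; linarith
  rw [mellin, mellin, ← integral_const_mul, ← integral_sub (mellinConvergent_expKernel h1)
    ((mellinConvergent_expKernel (by simp)).const_mul _), integralA]
  refine setIntegral_congr_fun measurableSet_Ioi fun t ht => ?_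
  have ht0 : 0 < t := ht
  have ht1 : (1 + t : ℂ) ≠ 0 := by exact_mod_cast (by positivity : 1 + t ≠ 0)
  have e1 : z + 2 - 1 = z + 1 := by ring
  have e2 : (2 - 1 : ℂ) = 1 := by norm_num
  simp only [smul_eq_mul, expKernel, e1, e2, Complex.cpow_one]
  push_cast
  rw [add_comm (t : ℂ) 1]
  field_simp

theorem neg_one_cpow_add_one (z : ℂ) : (-1 : ℂ) ^ (z + 1) = -(-1 : ℂ) ^ z := by
  rw [Complex.cpow_add _ _ (by norm_num), Complex.cpow_one, mul_neg_one]

/-- The Mellin recursion matches the continuation step, so on Re z > -2 the number of steps is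
immaterial. This half-plane contains the integers m ≥ -1, where A is therefore continuous. -/
theorem continuedA_eq (n : ℕ) {z : ℂ} (hz : -2 < z.re) :
    continuedA n z = mellin expKernel (z + 2) - (-1 : ℂ) ^ z * mellin expKernel 2 := by
  induction n generalizing z with
  | zero => exact integralA_eq hz
  | succ n ih =>
    have h1 : 0 < (z + 2).re := by simp; linarith
    rw [continuedA, ih (by simp; linarith), neg_one_cpow_add_one,
      show z + 1 + 2 = z + 2 + 1 by ring, mellin_expKernel_add_one h1]
    ring

theorem A_eq {z : ℂ} (hz : -2 < z.re) :
    A z = mellin expKernel (z + 2) - (-1 : ℂ) ^ z * mellin expKernel 2 :=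
  continuedA_eq _ hz

theorem continuousAt_A {z : ℂ} (hz : -2 < z.re) : ContinuousAt A z := by
  have hev : A =ᶠ[𝓝 z] fun z => mellin expKernel (z + 2) - (-1 : ℂ) ^ z * mellin expKernel 2 := by
    filter_upwards [(isOpen_lt continuous_const Complex.continuous_re).mem_nhds hz] with w hw
    exact A_eq hw
  have h1 : 0 < (z + 2).re := by simp; linarith
  refine ContinuousAt.congr ?_ hev.symm
  have h2 : ContinuousAt (fun z : ℂ => mellin expKernel (z + 2)) z :=
    ContinuousAt.comp (f := fun z : ℂ => z + 2)
      (differentiableAt_mellin_expKernel h1).continuousAt (by fun_prop)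
  have h3 : ContinuousAt (fun z : ℂ => (-1 : ℂ) ^ z) z :=
    continuousAt_const_cpow (by norm_num)
  exact h2.sub (h3.mul_const _)

/-! ### Evaluation of the Mellin transform -/

/-- Writing `1 / (1 + t)` as a Laplace integral and exchanging the integrations. -/
theorem mellin_expKernel_eq_gamma_mul {s : ℂ} (hs : 0 < s.re) :
    mellin expKernel s = Complex.Gamma s *
      ∫ u in Set.Ioi (0 : ℝ), Complex.exp (-u) * (u + 1 : ℂ) ^ (-s) := by
  have hL (t : ℝ) (ht : 0 < t) :
      ∫ u in Set.Ioi (0 : ℝ), Complex.exp (-((1 + t : ℝ) * u)) = (1 + t : ℂ)⁻¹ := by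
    have := Complex.integral_cpow_mul_exp_neg_mul_Ioi (a := 1) (r := 1 + t) (by simp)
      (by positivity)
    simpa using this
  -- Fubini applies because e^{-tu} ≤ 1 leaves a product of two integrable functions as a majorant.
  have hint : Integrable (Function.uncurry fun t u : ℝ =>
      ((Real.exp (-t) : ℝ) * (t : ℂ) ^ (s - 1)) * Complex.exp (-u) * Complex.exp (-(t * u)))
      ((volume.restrict (Set.Ioi 0)).prod (volume.restrict (Set.Ioi 0))) := by
    have hexp : IntegrableOn (fun u : ℝ => Complex.exp (-u)) (Set.Ioi 0) := by
      simpa using Complex.GammaIntegral_convergent (s := 1) (by simp)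
    refine (Integrable.mul_prod (Complex.GammaIntegral_convergent hs) hexp).mono
      (Measurable.aestronglyMeasurable (by unfold Function.uncurry; fun_prop)) ?_
    rw [Measure.prod_restrict]
    refine (ae_restrict_mem (measurableSet_Ioi.prod measurableSet_Ioi)).mono fun p hp => ?_
    have h1 : 0 < p.1 := hp.1
    have h2 : 0 < p.2 := hp.2
    rw [Function.uncurry, norm_mul]
    refine mul_le_of_le_one_right (norm_nonneg _) ?_
    rw [Complex.norm_exp, Real.exp_le_one_iff]
    simpa using (mul_pos h1 h2).le
  have hswap := integral_integral_swap hint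
  have hleft : mellin expKernel s = ∫ t in Set.Ioi (0 : ℝ), ∫ u in Set.Ioi (0 : ℝ),
      ((Real.exp (-t) : ℝ) * (t : ℂ) ^ (s - 1)) * Complex.exp (-u) * Complex.exp (-(t * u)) := by
    refine setIntegral_congr_fun measurableSet_Ioi fun t ht => ?_
    simp only [mul_assoc, integral_const_mul, ← Complex.exp_add, smul_eq_mul, expKernel]
    have he (u : ℝ) : (-u + -(t * u) : ℂ) = -((1 + t : ℝ) * u) := by push_cast; ring
    simp_rw [he]
    rw [hL t ht]
    push_cast
    ring
  rw [hleft, hswap, ← integral_const_mul]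
  refine setIntegral_congr_fun measurableSet_Ioi fun u hu => ?_
  have hu0 : 0 < u := hu
  have hu1 : (0 : ℝ) < u + 1 := by positivity
  have he (t : ℝ) : ((Real.exp (-t) : ℝ) * (t : ℂ) ^ (s - 1)) * Complex.exp (-u) *
      Complex.exp (-(t * u)) =
        Complex.exp (-u) * ((t : ℂ) ^ (s - 1) * Complex.exp (-((u + 1 : ℝ) * t))) := by
    rw [show (-((u + 1 : ℝ) * t) : ℂ) = -(t * u) + -t by push_cast; ring, Complex.exp_add]
    push_cast
    ring
  simp_rw [he]
  have harg : ((u + 1 : ℝ) : ℂ).arg ≠ Real.pi := by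
    rw [Complex.arg_ofReal_of_nonneg hu1.le]
    exact Real.pi_ne_zero.symm
  rw [integral_const_mul, Complex.integral_cpow_mul_exp_neg_mul_Ioi hs hu1, one_div,
    Complex.inv_cpow _ _ harg, ← Complex.cpow_neg]
  push_cast
  ring

/-- Termwise integration of the exponential series against `v^{a-1}` on the unit interval. -/
theorem hasSum_gamma_div_gamma {a : ℂ} (ha : 0 < a.re) :
    HasSum (fun j : ℕ => Complex.Gamma a * (Complex.Gamma (a + (j + 1)))⁻¹)
      (∫ v in (0 : ℝ)..1, (v : ℂ) ^ (a - 1) * Complex.exp (1 - v)) := by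
  -- Each term is the Beta integral B(a, j+1) divided by j!.
  have hterm (j : ℕ) : ∫ v in (0 : ℝ)..1, (v : ℂ) ^ (a - 1) * ((1 - v : ℂ) ^ j / j.factorial) =
      Complex.Gamma a * (Complex.Gamma (a + (j + 1)))⁻¹ := by
    have h := Complex.Gamma_mul_Gamma_eq_betaIntegral ha
      (show 0 < ((j : ℂ) + 1).re by simp; positivity)
    have hG : Complex.Gamma (a + (j + 1)) ≠ 0 :=
      Complex.Gamma_ne_zero_of_re_pos (by simp; positivity)
    have hj : (j.factorial : ℂ) ≠ 0 := by exact_mod_cast j.factorial_ne_zero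
    rw [Complex.Gamma_nat_eq_factorial, Complex.betaIntegral] at h
    simp only [add_sub_cancel_right, Complex.cpow_natCast] at h
    simp_rw [← mul_div_assoc]
    rw [intervalIntegral.integral_div]
    field_simp
    linear_combination -h
  simp_rw [← hterm]
  refine intervalIntegral.hasSum_integral_of_dominated_convergence
    (fun j v => v ^ (a.re - 1) * (1 / (j.factorial : ℝ))) (fun j => ?_) (fun j => ?_) ?_ ?_ ?_
  · refine Measurable.aestronglyMeasurable ?_
    fun_prop
  · refine ae_of_all _ fun v hv => ?_
    rw [Set.uIoc_of_le zero_le_one] at hv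
    rw [norm_mul, norm_div, norm_pow, Complex.norm_cpow_eq_rpow_re_of_pos hv.1]
    simp only [Complex.sub_re, Complex.one_re, Complex.norm_natCast]
    have h1 : ‖(1 - v : ℂ)‖ ≤ 1 := by
      rw [← Complex.ofReal_one, ← Complex.ofReal_sub, Complex.norm_real, Real.norm_eq_abs,
        abs_le]
      constructor <;> linarith [hv.1, hv.2]
    have := Real.rpow_nonneg hv.1.le (a.re - 1)
    gcongr
    exact pow_le_one₀ (norm_nonneg _) h1
  · refine ae_of_all _ fun v hv => ?_
    have := Real.summable_pow_div_factorial 1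
    simp only [one_pow] at this
    exact this.mul_left _
  · simp_rw [tsum_mul_left]
    exact (intervalIntegral.intervalIntegrable_rpow' (by linarith)).mul_const _
  · refine ae_of_all _ fun v hv => ?_
    have h := NormedSpace.expSeries_div_hasSum_exp (1 - v : ℂ)
    rw [← Complex.exp_eq_exp_ℂ] at h
    exact h.mul_left _

/-- With v = u + 1 the integral runs over (1, ∞); it is the integral over (0, ∞) minus that over (0,
1). The bound Re s < 1 gives integrability at v = 0. -/
theorem mellin_expKernel_eq_of_re_lt_one {s : ℂ} (hs : 0 < s.re) (hs1 : s.re < 1) :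
    mellin expKernel s = Real.pi / Complex.sin (Real.pi * s) *
      (Real.exp 1 - recipGammaSum (s - 2)) := by
  have ha : 0 < (1 - s).re := by simpa using hs1
  have hsum : ∫ v in (0 : ℝ)..1, (v : ℂ) ^ (1 - s - 1) * Complex.exp (1 - v) =
      Complex.Gamma (1 - s) * recipGammaSum (s - 2) := by
    rw [← (hasSum_gamma_div_gamma ha).tsum_eq, tsum_mul_left, recipGammaSum]
    congr 1
    refine tsum_congr fun n => ?_
    congr 2
    ring
  have hshift : ∫ u in Set.Ioi (0 : ℝ), Complex.exp (-u) * (u + 1 : ℂ) ^ (-s) =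
      ∫ v in Set.Ioi (1 : ℝ), (v : ℂ) ^ (1 - s - 1) * Complex.exp (1 - v) := by
    rw [← setIntegral_Ioi_comp_add_one]
    refine setIntegral_congr_fun measurableSet_Ioi fun u hu => ?_
    simp only [Complex.ofReal_add, Complex.ofReal_one]
    rw [mul_comm]
    congr 2 <;> ring
  have hexp (v : ℝ) : (v : ℂ) ^ (1 - s - 1) * Complex.exp (1 - v) =
      Real.exp 1 * ((Real.exp (-v) : ℝ) * (v : ℂ) ^ (1 - s - 1)) := by
    rw [sub_eq_add_neg (1 : ℂ) v, Complex.exp_add]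
    push_cast
    ring
  have hI : IntegrableOn (fun v : ℝ => (v : ℂ) ^ (1 - s - 1) * Complex.exp (1 - v))
      (Set.Ioi 0) := by
    simp_rw [hexp]
    exact (Complex.GammaIntegral_convergent ha).const_mul _
  have htot : ∫ v in Set.Ioi (0 : ℝ), (v : ℂ) ^ (1 - s - 1) * Complex.exp (1 - v) =
      Real.exp 1 * Complex.Gamma (1 - s) := by
    simp_rw [hexp]
    rw [integral_const_mul, Complex.Gamma_eq_integral ha, Complex.GammaIntegral]
  have hsplit := intervalIntegral.integral_interval_add_Ioi hI
    (hI.mono_set (Set.Ioi_subset_Ioi zero_le_one))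
  rw [mellin_expKernel_eq_gamma_mul hs, hshift, ← Complex.Gamma_mul_Gamma_one_sub]
  linear_combination Complex.Gamma s * (hsplit + htot - hsum)

/-- Multiplying by the sine removes the poles, so both sides are analytic on the half-plane and
agree near 1/2. -/
theorem sin_mul_mellin_expKernel {s : ℂ} (hs : 0 < s.re) :
    Complex.sin (Real.pi * s) * mellin expKernel s =
      Real.pi * (Real.exp 1 - recipGammaSum (s - 2)) := by
  have hopen : IsOpen {s : ℂ | 0 < s.re} := isOpen_lt continuous_const Complex.continuous_re
  have hconv : Convex ℝ {s : ℂ | 0 < s.re} := convex_halfSpace_re_gt 0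
  have hF : AnalyticOnNhd ℂ (fun s => Complex.sin (Real.pi * s) * mellin expKernel s)
      {s : ℂ | 0 < s.re} := by
    refine DifferentiableOn.analyticOnNhd (fun s hs => ?_) hopen
    exact (DifferentiableAt.mul (by fun_prop)
      (differentiableAt_mellin_expKernel hs)).differentiableWithinAt
  have hG : AnalyticOnNhd ℂ (fun s : ℂ => Real.pi * (Real.exp 1 - recipGammaSum (s - 2)))
      {s : ℂ | 0 < s.re} := by
    refine DifferentiableOn.analyticOnNhd (Differentiable.differentiableOn ?_) hopen
    have := differentiable_recipGammaSum
    fun_prop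
  have h0 : (1 / 2 : ℂ) ∈ {s : ℂ | 0 < s.re} := by simp
  refine hF.eqOn_of_preconnected_of_eventuallyEq hG hconv.isPreconnected h0 ?_ hs
  have hstrip : {s : ℂ | 0 < s.re} ∩ {s : ℂ | s.re < 1} ∈ 𝓝 (1 / 2 : ℂ) := by
    refine (hopen.inter (isOpen_lt Complex.continuous_re continuous_const)).mem_nhds ⟨h0, ?_⟩
    norm_num
  filter_upwards [hstrip] with w hw
  obtain ⟨hw0, hw1⟩ := hw
  simp only [Set.mem_ofPred_eq] at hw0 hw1
  have hsin : Complex.sin (Real.pi * w) ≠ 0 := by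
    refine sin_pi_mul_ne_zero fun m hm => ?_
    rw [hm, Complex.intCast_re] at hw0 hw1
    norm_cast at hw0 hw1
    omega
  rw [mellin_expKernel_eq_of_re_lt_one hw0 hw1]
  field_simp

/-! ### Closed form off the integers -/

/-- The closed form of the alternating Kurepa function off the integers. -/
noncomputable def closedForm (z : ℂ) : ℂ :=
  -(1 + (Real.exp 1 : ℂ) * (Ei (-1) : ℂ)) * (-1 : ℂ) ^ z
    + Real.pi / Complex.sin (Real.pi * z) * (Real.exp 1 - recipGammaSum z)

theorem sin_pi_mul_add_one (z : ℂ) :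
    Complex.sin (Real.pi * (z + 1)) = -Complex.sin (Real.pi * z) := by
  rw [mul_add, mul_one, Complex.sin_add_pi]

theorem sin_pi_mul_add_two (z : ℂ) :
    Complex.sin (Real.pi * (z + 2)) = Complex.sin (Real.pi * z) := by
  rw [← one_add_one_eq_two, ← add_assoc, sin_pi_mul_add_one, sin_pi_mul_add_one, neg_neg]

theorem A_eq_closedForm_of_re {z : ℂ} (hz : ∀ m : ℤ, z ≠ m) (hre : -2 < z.re) :
    A z = closedForm z := by
  have hs := sin_pi_mul_ne_zero hz
  have h := sin_mul_mellin_expKernel (s := z + 2) (by simp; linarith)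
  rw [sin_pi_mul_add_two, add_sub_cancel_right] at h
  rw [A_eq hre, mellin_expKernel_two, closedForm, div_mul_eq_mul_div, ← h,
    mul_div_cancel_left₀ _ hs]
  ring

/-- Passing from z to z + 1 flips the sign of (-1)^z and of the sine, and S gains one term, which
reflects to Γ(z+2). -/
theorem closedForm_eq_gamma_sub {z : ℂ} (hz : ∀ m : ℤ, z ≠ m) :
    closedForm z = Complex.Gamma (z + 2) - closedForm (z + 1) := by
  have hz1 : ∀ m : ℤ, z + 1 ≠ m := fun m hm => hz (m - 1) (by push_cast; linear_combination hm)
  have hG := neg_one_pow_mul_gamma hz1 0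
  rw [pow_zero, one_mul, Nat.cast_zero, sub_zero, zero_sub, neg_add',
    sin_pi_mul_add_one, show z + 1 + 1 = z + 2 by ring, show -z - 1 = -1 - z by ring] at hG
  rw [closedForm, closedForm, neg_one_cpow_add_one, sin_pi_mul_add_one, recipGammaSum_add_one, hG]
  simp only [div_neg]
  ring

theorem continuedA_eq_closedForm (n : ℕ) {z : ℂ} (hz : ∀ m : ℤ, z ≠ m) (hre : 0 < z.re + n) :
    continuedA n z = closedForm z := by
  induction n generalizing z with
  | zero =>
    rw [← A_eq_closedForm_of_re hz (by simp at hre; linarith), A_eq (by simp at hre; linarith),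
      continuedA_eq _ (by simp at hre; linarith)]
  | succ n ih =>
    rw [continuedA, closedForm_eq_gamma_sub hz, ih]
    · exact fun m hm => hz (m - 1) (by push_cast; linear_combination hm)
    · push_cast at hre
      simp
      linarith

theorem A_eq_closedForm {z : ℂ} (hz : ∀ m : ℤ, z ≠ m) : A z = closedForm z := by
  refine continuedA_eq_closedForm _ hz ?_
  have := Nat.lt_floor_add_one (1 - z.re)
  linarith

/-! ### Behaviour at the integers -/

theorem eventually_ne_intCast (m : ℤ) : ∀ᶠ z : ℂ in 𝓝[≠] (m : ℂ), ∀ k : ℤ, z ≠ k := by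
  filter_upwards [self_mem_nhdsWithin, mem_nhdsWithin_of_mem_nhds (Metric.ball_mem_nhds _ one_pos)]
    with z hz hz1 k hk
  rw [hk] at hz hz1
  have h1 : ‖((k - m : ℤ) : ℂ)‖ < 1 := by
    simpa [dist_eq_norm] using hz1
  rw [Complex.norm_intCast] at h1
  norm_cast at h1
  have h2 := Int.abs_lt_one_iff.1 h1
  exact hz (by rw [sub_eq_zero.1 h2]; rfl)

/-- Near an integer, `π / sin (π z)` is an analytic function divided by `z - m`. -/
theorem exists_analyticAt_pi_div_sin (m : ℤ) : ∃ q : ℂ → ℂ, AnalyticAt ℂ q m ∧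
    ∀ z : ℂ, z ≠ m → Real.pi / Complex.sin (Real.pi * z) = q z / (z - m) := by
  have hsin : Differentiable ℂ fun z : ℂ => Complex.sin (Real.pi * z) := by fun_prop
  have hm : Complex.sin (Real.pi * m) = 0 := by
    rw [mul_comm]; exact Complex.sin_int_mul_pi m
  have hder : deriv (fun z : ℂ => Complex.sin (Real.pi * z)) m ≠ 0 := by
    have h1 : HasDerivAt (fun z : ℂ => Complex.sin (Real.pi * z))
        (Complex.cos (Real.pi * m) * (Real.pi * 1)) m :=
      ((hasDerivAt_id' (m : ℂ)).const_mul (Real.pi : ℂ)).csin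
    rw [h1.deriv, mul_one]
    refine mul_ne_zero (fun h => ?_) (Complex.ofReal_ne_zero.2 Real.pi_ne_zero)
    have := Complex.sin_sq_add_cos_sq (Real.pi * m)
    rw [hm, h] at this
    norm_num at this
  obtain ⟨p, hp⟩ := hsin.analyticAt m
  -- The divided slope of the sine at m is analytic and equals the nonzero derivative at m itself.
  refine ⟨fun z => Real.pi / dslope (fun z : ℂ => Complex.sin (Real.pi * z)) m z,
    analyticAt_const.div ⟨_, hp.has_fpower_series_dslope_fslope⟩ (by rwa [dslope_same]),
    fun z hz => ?_⟩
  have hz' := sub_ne_zero.2 hz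
  simp only [dslope_of_ne _ hz, slope_def_field, hm, sub_zero]
  field_simp

end AltKurepa

open AltKurepa in
theorem mainTheorem1 :
    (∀ z : ℂ, (∀ m : ℤ, z ≠ m) →
      Summable (fun n : ℕ => (-1 : ℂ) ^ n * Complex.Gamma (z + 1 - n)) ∧
      AltKurepa.A z =
        -(1 + (Real.exp 1 : ℂ) * (AltKurepa.Ei (-1) : ℂ)) * (-1 : ℂ) ^ z
          + (Real.pi : ℂ) * (Real.exp 1 : ℂ) / Complex.sin (Real.pi * z)
          + ∑' n : ℕ, (-1 : ℂ) ^ n * Complex.Gamma (z + 1 - n)) ∧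
    (∀ m : ℤ, ∃ (a b c d : ℂ) (g : ℕ → ℂ),
      AltKurepa.HasPrincipalValue AltKurepa.A m a ∧
      AltKurepa.HasPrincipalValue
        (fun z => -(1 + (Real.exp 1 : ℂ) * (AltKurepa.Ei (-1) : ℂ)) * (-1 : ℂ) ^ z) m b ∧
      AltKurepa.HasPrincipalValue
        (fun z => (Real.pi : ℂ) * (Real.exp 1 : ℂ) / Complex.sin (Real.pi * z)) m c ∧
      AltKurepa.HasPrincipalValue
        (fun z => ∑' n : ℕ, (-1 : ℂ) ^ n * Complex.Gamma (z + 1 - n)) m d ∧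
      (∀ n : ℕ, AltKurepa.HasPrincipalValue
        (fun z => (-1 : ℂ) ^ n * Complex.Gamma (z + 1 - n)) m (g n)) ∧
      HasSum g d ∧
      b = -(1 + (Real.exp 1 : ℂ) * (AltKurepa.Ei (-1) : ℂ)) * (-1 : ℂ) ^ m ∧
      (-1 ≤ m → a = AltKurepa.A m) ∧
      a = b + c + d) := by
  refine ⟨fun z hz => ⟨(hasSum_gamma hz).summable, ?_⟩, fun m => ?_⟩
  · rw [A_eq_closedForm hz, (hasSum_gamma hz).tsum_eq, closedForm]
    ring
  obtain ⟨q, hq, hqz⟩ := exists_analyticAt_pi_div_sin m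
  have hS : AnalyticAt ℂ recipGammaSum m := differentiable_recipGammaSum.analyticAt m
  have hR (n : ℕ) : AnalyticAt ℂ (fun z : ℂ => (Complex.Gamma (n - z))⁻¹) m :=
    (differentiable_recipGamma_sub n).analyticAt m
  set K : ℂ := 1 + (Real.exp 1 : ℂ) * (Ei (-1) : ℂ)
  have hpow : AnalyticAt ℂ (fun z : ℂ => -K * (-1 : ℂ) ^ z) m :=
    Differentiable.analyticAt
      (fun z => (differentiableAt_id.const_cpow (Or.inl (by norm_num))).const_mul _) _
  have hb : AnalyticAt ℂ (fun z : ℂ => (z - m) * (-K * (-1 : ℂ) ^ z)) m :=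
    (analyticAt_id.sub analyticAt_const).mul hpow
  have hc : AnalyticAt ℂ (fun z : ℂ => q z * Real.exp 1) m := hq.mul analyticAt_const
  have hd : AnalyticAt ℂ (fun z : ℂ => -q z * recipGammaSum z) m := hq.neg.mul hS
  have ha := (hb.add hc).add hd
  have hderb : deriv (fun z : ℂ => (z - m) * (-K * (-1 : ℂ) ^ z)) m = -K * (-1 : ℂ) ^ m := by
    have := ((hasDerivAt_id' (m : ℂ)).sub_const (m : ℂ)).fun_mul hpow.differentiableAt.hasDerivAt
    simpa using this.deriv
  have hA : A =ᶠ[𝓝[≠] (m : ℂ)] fun z => ((fun z : ℂ => (z - m) * (-K * (-1 : ℂ) ^ z)) +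
      (fun z : ℂ => q z * Real.exp 1) + fun z : ℂ => -q z * recipGammaSum z) z / (z - m) := by
    filter_upwards [self_mem_nhdsWithin, eventually_ne_intCast m] with z hzm hz
    have hzm' := sub_ne_zero.2 hzm
    rw [A_eq_closedForm hz, closedForm, hqz z hzm]
    simp only [Pi.add_apply]
    field_simp
    ring
  refine ⟨_, -K * (-1 : ℂ) ^ m, _, _, fun n => deriv (fun z => -q z * (Complex.Gamma (n - z))⁻¹) m,
    hasPrincipalValue_of_eventuallyEq_div ha hA, ?_,
    hasPrincipalValue_of_eventuallyEq_div hc ?_, hasPrincipalValue_of_eventuallyEq_div hd ?_,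
    fun n => hasPrincipalValue_of_eventuallyEq_div (hq.neg.mul (hR n)) ?_, ?_, rfl,
    fun hm => ?_, ?_⟩
  · simpa using hasPrincipalValue_of_analyticAt hpow
  · filter_upwards [self_mem_nhdsWithin] with z hzm
    rw [mul_div_right_comm, hqz z hzm]
    ring
  · filter_upwards [self_mem_nhdsWithin, eventually_ne_intCast m] with z hzm hz
    rw [(hasSum_gamma hz).tsum_eq, hqz z hzm]
    ring
  · filter_upwards [self_mem_nhdsWithin, eventually_ne_intCast m] with z hzm hz
    rw [neg_one_pow_mul_gamma hz, hqz z hzm]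
    ring
  -- By the product rule the termwise sum reduces to the series for S and for its derivative.
  · have hprod (f : ℂ → ℂ) (hf : AnalyticAt ℂ f m) : deriv (fun z => -q z * f z) m =
        -deriv q m * f m + -q m * deriv f m :=
      (hq.differentiableAt.hasDerivAt.fun_neg.fun_mul hf.differentiableAt.hasDerivAt).deriv
    rw [hprod _ hS]
    simp_rw [fun n => hprod _ (hR n)]
    exact ((summable_recipGamma m).hasSum.mul_left _).add
      ((hasSum_deriv_recipGamma m).mul_left _)
  -- For m ≥ -1 the poles of the summands cancel: A is continuous at m, so the quotient tends to
  -- A(m).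
  · refine deriv_eq_of_tendsto_div ha (Tendsto.congr' hA ?_)
    have hre : -2 < (m : ℂ).re := by
      rw [Complex.intCast_re]
      exact_mod_cast (by omega : -2 < m)
    exact (continuousAt_A hre).tendsto.mono_left inf_le_left
  · rw [← hderb, deriv_add (hb.add hc).differentiableAt hd.differentiableAt,
      deriv_add hb.differentiableAt hc.differentiableAt]
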